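/- Let $P\in\mathbb{R}^{n\times n}$ be symmetric positive semidefinite, $q\in\mathbb{R}^n$, $A\in\mathbb{R}^{m\times n}$, and let $\mathcal{C}\subseteq\mathbb{R}^m$ be nonempty, closed and convex, with Euclidean projection $\Pi_{\mathcal C}$. Consider the problem of minimizing $\frac12 x^TPx+q^Tx$ subject to $Ax=z$, $z\in\mathcal{C}$ (no feasibility or solvability is assumed). Let $\rho>0$, $\sigma>0$, $\alpha\in(0,2)$, let $(\mu^k)_{k\in\mathbb{N}}$, $(\nu^k)_{k\in\mathbb{N}}$ be summable nonnegative sequences, and write $u\approx_{\epsilon}v$ for $\|u-v\|_2\le\epsilon$. Approximate ADMM starts from arbitrary $x^0\in\mathbb{R}^n$, $y^0,z^0\in\mathbb{R}^m$ and generates, for $k=0,1,2,\dots$, any points satisfying $$\begin{bmatrix}\tilde x^{k+1}\\ \tilde z^{k+1}\end{bmatrix}\approx_{\mu^k}\begin{bmatrix}P+\sigma I&\rho A^T\\ \rho A&-\rho I\end{bmatrix}^{-1}\left(\begin{bmatrix}\sigma I&\rho A^T\\0&0\end{bmatrix}\begin{bmatrix}x^k\\z^k-y^k/\rho\end{bmatrix}-\begin{bmatrix}q\\0\end{bmatrix}\right),$$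 $$x^{k+1}=\alpha\tilde x^{k+1}+(1-\alpha)x^k,\qquad z^{k+1}\approx_{\nu^k}\Pi_{\mathcal C}\big(\alpha\tilde z^{k+1}+(1-\alpha)z^k+y^k/\rho\big),$$ $$y^{k+1}=y^k+\rho\big(\alpha\tilde z^{k+1}+(1-\alpha)z^k-z^{k+1}\big).$$ Exact ADMM is the same iteration with $\mu^k=\nu^k=0$ for all $k$. Then, for any iterates of approximate ADMM, the limits $$\delta x=\lim_{k\to\infty}(x^{k+1}-x^k),\qquad \delta y=\lim_{k\to\infty}(y^{k+1}-y^k)$$ exist. They are equal to the corresponding limits (which also exist) of the iterates of exact ADMM with the same $P,q,A,\mathcal C,\rho,\sigma,\alpha$, from any initial values, in particular from the same ones. -/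

import Mathlib

open Filter Topology
open scoped Matrix

/-- A Euclidean projection of `v` onto `C`, chosen among the points of `C` nearest to `v`.
It is *the* projection when `C` is nonempty, closed and convex,
see `admmProj_spec` and `admmProj_unique`. -/
noncomputable def admmProj {m : ℕ} (C : Set (EuclideanSpace ℝ (Fin m)))
    (v : EuclideanSpace ℝ (Fin m)) : EuclideanSpace ℝ (Fin m) :=
  Classical.epsilon fun p => p ∈ C ∧ ∀ w ∈ C, ‖v - p‖ ≤ ‖v - w‖

theorem admmProj_spec {m : ℕ} {C : Set (EuclideanSpace ℝ (Fin m))} (hne : C.Nonempty)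
    (hcl : IsClosed C) (v : EuclideanSpace ℝ (Fin m)) :
    admmProj C v ∈ C ∧ ∀ w ∈ C, ‖v - admmProj C v‖ ≤ ‖v - w‖ := by
  obtain ⟨p, hp, h⟩ := hcl.exists_infDist_eq_dist hne v
  refine Classical.epsilon_spec (p := fun p => p ∈ C ∧ ∀ w ∈ C, ‖v - p‖ ≤ ‖v - w‖)
    ⟨p, hp, fun w hw => ?_⟩
  rw [← dist_eq_norm, ← dist_eq_norm, ← h]
  exact Metric.infDist_le_dist_of_mem hw

theorem admmProj_unique {m : ℕ} {C : Set (EuclideanSpace ℝ (Fin m))} (hcl : IsClosed C)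
    (hcv : Convex ℝ C) {v p : EuclideanSpace ℝ (Fin m)} (hp : p ∈ C)
    (h : ∀ w ∈ C, ‖v - p‖ ≤ ‖v - w‖) : admmProj C v = p := by
  obtain ⟨hq, hq'⟩ := admmProj_spec ⟨p, hp⟩ hcl v
  set r := admmProj C v
  have hmid : midpoint ℝ p r ∈ C := hcv.midpoint_mem hp hq
  have heq : ‖v - r‖ = ‖v - p‖ := le_antisymm (hq' p hp) (h r hq)
  have h1 := h _ hmid
  have hpar := parallelogram_law_with_norm ℝ (v - p) (v - r)
  have e1 : (v - p) + (v - r) = (2 : ℝ) • (v - midpoint ℝ p r) := by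
    rw [midpoint_eq_smul_add, invOf_eq_inv]; module
  have e2 : (v - p) - (v - r) = r - p := by abel
  rw [e1, e2, norm_smul, heq] at hpar
  norm_num at hpar
  have h2 : ‖v - p‖ ^ 2 ≤ ‖v - midpoint ℝ p r‖ ^ 2 := by gcongr
  have h3 : ‖r - p‖ = 0 := by
    have : ‖r - p‖ * ‖r - p‖ ≤ 0 := by nlinarith
    nlinarith [norm_nonneg (r - p)]
  exact sub_eq_zero.mp (norm_eq_zero.mp h3)

/-- The matrix `[P + σI, ρAᵀ; ρA, -ρI]` of the linear systems solved by ADMM. -/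
def admmMatrix {n m : ℕ} (P : Matrix (Fin n) (Fin n) ℝ) (A : Matrix (Fin m) (Fin n) ℝ)
    (ρ σ : ℝ) : Matrix (Fin n ⊕ Fin m) (Fin n ⊕ Fin m) ℝ :=
  Matrix.fromBlocks (P + σ • 1) (ρ • Aᵀ) (ρ • A) (-(ρ • 1))

/-- The matrix of the linear system is invertible, so that `⁻¹` is the genuine inverse. -/
theorem admmMatrix_isUnit_det {n m : ℕ} {P : Matrix (Fin n) (Fin n) ℝ} (hP : P.PosSemidef)
    (A : Matrix (Fin m) (Fin n) ℝ) {ρ σ : ℝ} (hρ : 0 < ρ) (hσ : 0 < σ) :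
    IsUnit (admmMatrix P A ρ σ).det := by
  rw [isUnit_iff_ne_zero]
  intro h0
  obtain ⟨v, hv, hMv⟩ := Matrix.exists_mulVec_eq_zero_iff.mpr h0
  apply hv
  set a : Fin n → ℝ := v ∘ Sum.inl
  set b : Fin m → ℝ := v ∘ Sum.inr
  rw [admmMatrix, Matrix.fromBlocks_mulVec] at hMv
  have h1 : (P + σ • 1) *ᵥ a + (ρ • Aᵀ) *ᵥ b = 0 := by
    funext i; simpa using congrFun hMv (Sum.inl i)
  have h2 : (ρ • A) *ᵥ a + (-(ρ • 1)) *ᵥ b = 0 := by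
    funext i; simpa using congrFun hMv (Sum.inr i)
  have hb : b = A *ᵥ a := by
    have h3 : ρ • (A *ᵥ a - b) = 0 := by
      rw [← h2, Matrix.smul_mulVec, Matrix.neg_mulVec, Matrix.smul_mulVec, Matrix.one_mulVec,
        smul_sub, sub_eq_add_neg]
    exact (sub_eq_zero.mp ((smul_eq_zero.mp h3).resolve_left hρ.ne')).symm
  have h4 : a ⬝ᵥ (P *ᵥ a) + σ * (a ⬝ᵥ a) + ρ * (b ⬝ᵥ b) = 0 := by
    have h5 := congrArg (fun w => a ⬝ᵥ w) h1
    simp only [Matrix.add_mulVec, Matrix.smul_mulVec, Matrix.one_mulVec, dotProduct_add,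
      dotProduct_smul, smul_eq_mul, dotProduct_zero, Matrix.dotProduct_mulVec a Aᵀ,
      Matrix.vecMul_transpose] at h5
    rwa [← hb] at h5
  have h6 : 0 ≤ a ⬝ᵥ (P *ᵥ a) := by simpa using hP.dotProduct_mulVec_nonneg a
  have h7 : 0 ≤ a ⬝ᵥ a := Finset.sum_nonneg fun i _ => mul_self_nonneg (a i)
  have h8 : 0 ≤ b ⬝ᵥ b := Finset.sum_nonneg fun i _ => mul_self_nonneg (b i)
  have h9 : a ⬝ᵥ a = 0 := by
    nlinarith [mul_nonneg hσ.le h7, mul_nonneg hρ.le h8]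
  have ha : a = 0 := dotProduct_self_eq_zero.mp h9
  have hb0 : b = 0 := by rw [hb, ha, Matrix.mulVec_zero]
  funext i
  cases i with
  | inl i => exact congrFun ha i
  | inr i => exact congrFun hb0 i

/-- The stacked vector `[x; z]`, with the Euclidean norm. -/
def admmStack {n m : ℕ} (x : EuclideanSpace ℝ (Fin n)) (z : EuclideanSpace ℝ (Fin m)) :
    EuclideanSpace ℝ (Fin n ⊕ Fin m) :=
  WithLp.toLp 2 (Sum.elim x.ofLp z.ofLp)

/-- The exact solution `[P + σI, ρAᵀ; ρA, -ρI] \ ([σI, ρAᵀ; 0, 0] [x; z - y/ρ] - [q; 0])`. -/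
noncomputable def admmSolve {n m : ℕ} (P : Matrix (Fin n) (Fin n) ℝ)
    (q : EuclideanSpace ℝ (Fin n)) (A : Matrix (Fin m) (Fin n) ℝ) (ρ σ : ℝ)
    (x : EuclideanSpace ℝ (Fin n)) (y z : EuclideanSpace ℝ (Fin m)) :
    EuclideanSpace ℝ (Fin n ⊕ Fin m) :=
  WithLp.toLp 2 ((admmMatrix P A ρ σ)⁻¹ *ᵥ
    (Matrix.fromBlocks (σ • 1) (ρ • Aᵀ) 0 0 *ᵥ (admmStack x (z - ρ⁻¹ • y)).ofLp
      - (admmStack q 0).ofLp))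

/-- `(x, y, z)` are iterates of approximate ADMM (with intermediate iterates `xt`, `zt`) for
minimizing `½ xᵀPx + qᵀx` subject to `Ax = z`, `z ∈ C`, with parameters `ρ, σ, α`
and error bounds `μ, ν`. The initial values are `x 0`, `y 0`, `z 0`;
the values `xt 0`, `zt 0` are not used. -/
structure IsApproxADMM {n m : ℕ} (P : Matrix (Fin n) (Fin n) ℝ) (q : EuclideanSpace ℝ (Fin n))
    (A : Matrix (Fin m) (Fin n) ℝ) (C : Set (EuclideanSpace ℝ (Fin m))) (ρ σ α : ℝ)
    (μ ν : ℕ → ℝ) (x xt : ℕ → EuclideanSpace ℝ (Fin n))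
    (y z zt : ℕ → EuclideanSpace ℝ (Fin m)) : Prop where
  linear_step : ∀ k,
    ‖admmStack (xt (k + 1)) (zt (k + 1)) - admmSolve P q A ρ σ (x k) (y k) (z k)‖ ≤ μ k
  x_step : ∀ k, x (k + 1) = α • xt (k + 1) + (1 - α) • x k
  z_step : ∀ k,
    ‖z (k + 1) - admmProj C (α • zt (k + 1) + (1 - α) • z k + ρ⁻¹ • y k)‖ ≤ ν k
  y_step : ∀ k, y (k + 1) = y k + ρ • (α • zt (k + 1) + (1 - α) • z k - z (k + 1))

/-!
With `v = z + y / ρ`, one step of exact ADMM maps `(x, v)` to `(x, v) + α (xt - x, A xt - Π v)`,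
where `xt` solves the linear system with data `x` and `2 Π v - v`. In the norm
`√(σ ‖x‖² + ρ ‖v‖²)` this is an averaged operator `T` (`admmOperator_averaged`): the linear system
is the optimality condition of a convex quadratic problem, hence monotone in its data, and the
projection `Π` is firmly nonexpansive. Approximate ADMM, from its second iterate on, is an orbit of
`T` with summable errors (`IsApproxADMM.norm_state_sub_admmOperator_le`).

For an averaged operator `T` on a finite-dimensional space the increments of every such orbit
converge to one and the same vector `-w` (`exists_tendsto_increment`), even if `T` has no fixed
point. Here `w` is a limit of displacements `p - T p` with `‖w‖² ≤ ⟪p - T p, w⟫` for all `p`; it is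
found along the fixed points of the contractions `r • T` as `r → 1`
(`exists_minimal_displacement`). An exact orbit that starts at a point with displacement almost `w`
keeps displacements of almost minimal norm, which are then close to `w`; and the displacements of
any two orbits, exact or with summable errors, approach each other, because the squares of their
differences are controlled by the decrease of the squared distance of the orbits
(`tendsto_displacement_sub_displacement`).

This gives the limits of the increments of `x` and of `z + y / ρ`. The two parts of the solution of
the linear system are linked by `zt ≈ A xt`, so `z - A x` converges, the increments of `z` tend to
`A δx`, and those of `y` converge as well (`IsApproxADMM.tendsto_y_increment`).
-/

/-! ### Inexact orbits of averaged operators -/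

section AveragedOperator

variable {E : Type*} [NormedAddCommGroup E]

theorem norm_map_sub_le_of_averaged {T : E → E} {c : ℝ} (hc : 0 ≤ c)
    (hT : ∀ s t, ‖T s - T t‖ ^ 2 + c * ‖(s - T s) - (t - T t)‖ ^ 2 ≤ ‖s - t‖ ^ 2) (s t : E) :
    ‖T s - T t‖ ≤ ‖s - t‖ := by
  refine le_of_sq_le_sq ?_ (norm_nonneg _)
  linarith [hT s t, mul_nonneg hc (sq_nonneg ‖(s - T s) - (t - T t)‖)]

/-- An inexact orbit with summable errors and an exact orbit of an averaged operator have
asymptotically equal displacements, since their distance converges. -/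
theorem tendsto_displacement_sub_displacement {T : E → E} {c : ℝ} (hc : 0 < c)
    (hT : ∀ s t, ‖T s - T t‖ ^ 2 + c * ‖(s - T s) - (t - T t)‖ ^ 2 ≤ ‖s - t‖ ^ 2)
    {s t : ℕ → E} {e : ℕ → ℝ} (he : Summable e) (hs : ∀ k, ‖s (k + 1) - T (s k)‖ ≤ e k)
    (ht : ∀ k, t (k + 1) = T (t k)) :
    Tendsto (fun k => (s k - T (s k)) - (t k - T (t k))) atTop (𝓝 0) := by
  have hne := norm_map_sub_le_of_averaged hc.le hT
  have he0 : ∀ k, 0 ≤ e k := fun k => (norm_nonneg _).trans (hs k)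
  have hstep : ∀ k, ‖s (k + 1) - t (k + 1)‖ ≤ ‖T (s k) - T (t k)‖ + e k := fun k => by
    have h1 : s (k + 1) - t (k + 1) = (T (s k) - T (t k)) + (s (k + 1) - T (s k)) := by
      rw [ht]; abel
    rw [h1]
    exact (norm_add_le _ _).trans (by linarith [hs k])
  have hlim : ∃ b, Tendsto (fun k => ‖s k - t k‖) atTop (𝓝 b) := by
    -- Subtracting the accumulated errors makes the distances monotone.
    have hanti : Antitone fun k => ‖s k - t k‖ - ∑ i ∈ Finset.range k, e i :=
      antitone_nat_of_succ_le fun k => by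
        rw [Finset.sum_range_succ]
        linarith [hstep k, hne (s k) (t k)]
    have hbdd : BddBelow (Set.range fun k => ‖s k - t k‖ - ∑ i ∈ Finset.range k, e i) := by
      refine ⟨-∑' i, e i, ?_⟩
      rintro _ ⟨k, rfl⟩
      have := he.sum_le_tsum (Finset.range k) (fun i _ => he0 i)
      dsimp only
      linarith [norm_nonneg (s k - t k)]
    refine ⟨_, ((tendsto_atTop_ciInf hanti hbdd).add he.hasSum.tendsto_sum_nat).congr fun k => ?_⟩
    ring
  obtain ⟨b, hb⟩ := hlim
  have hTb : Tendsto (fun k => ‖T (s k) - T (t k)‖) atTop (𝓝 b) := by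
    refine tendsto_of_tendsto_of_tendsto_of_le_of_le
      (g := fun k => ‖s (k + 1) - t (k + 1)‖ - e k) ?_ hb (fun k => ?_) (fun k => hne _ _)
    · simpa using ((tendsto_add_atTop_iff_nat 1).2 hb).sub he.tendsto_atTop_zero
    · dsimp only
      linarith [hstep k]
  have hsq : Tendsto (fun k => ‖(s k - T (s k)) - (t k - T (t k))‖ ^ 2) atTop (𝓝 0) := by
    have h1 : Tendsto (fun k => c⁻¹ * (‖s k - t k‖ ^ 2 - ‖T (s k) - T (t k)‖ ^ 2)) atTop (𝓝 0) := by
      simpa using ((hb.pow 2).sub (hTb.pow 2)).const_mul c⁻¹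
    refine squeeze_zero (fun k => sq_nonneg _) (fun k => ?_) h1
    rw [inv_mul_eq_div, le_div_iff₀ hc]
    linarith [hT (s k) (t k)]
  rw [tendsto_zero_iff_norm_tendsto_zero]
  simpa using hsq.sqrt

end AveragedOperator

/-! ### The minimal displacement vector -/

section MinimalDisplacement

variable {E : Type*} [NormedAddCommGroup E] [InnerProductSpace ℝ E]

/-- The displacement `p ↦ p - T p` of a nonexpansive map is a monotone operator. -/
theorem inner_displacement_sub_nonneg {T : E → E} (hT : ∀ s t, ‖T s - T t‖ ≤ ‖s - t‖) (s t : E) :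
    0 ≤ inner ℝ ((s - T s) - (t - T t)) (s - t) := by
  have h1 : (s - T s) - (t - T t) = (s - t) - (T s - T t) := by abel
  rw [h1, inner_sub_left, real_inner_self_eq_norm_mul_norm]
  have h2 := real_inner_le_norm (T s - T t) (s - t)
  have h3 := mul_le_mul_of_nonneg_right (hT s t) (norm_nonneg (s - t))
  linarith

/-- A nonexpansive map has a minimal displacement vector `w`: it is a limit of displacements, and
it is the point of smallest norm of the closed convex hull of the displacements. It arises as a
limit of `p - T p` along the fixed points `p` of the contractions `r • T`, as `r` tends to `1`. -/
theorem exists_minimal_displacement [ProperSpace E] {T : E → E}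
    (hT : ∀ s t, ‖T s - T t‖ ≤ ‖s - t‖) :
    ∃ w ∈ closure (Set.range fun p => p - T p), ∀ p, ‖w‖ ^ 2 ≤ inner ℝ (p - T p) w := by
  set l : ℕ → ℝ := fun n => 1 / ((n : ℝ) + 1 + 1) with hl
  have hl0 : ∀ n, 0 < l n := fun n => by positivity
  have hl1 : ∀ n, l n < 1 := fun n => by
    rw [hl]; dsimp only; rw [div_lt_one (by positivity)]
    linarith [Nat.cast_nonneg (α := ℝ) n]
  have hllim : Tendsto l atTop (𝓝 0) :=
    ((tendsto_add_atTop_iff_nat 1).2 (tendsto_one_div_add_atTop_nhds_zero_nat (𝕜 := ℝ))).congr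
      fun n => by simp [hl]
  have hfix : ∀ n, ∃ p : E, (1 - l n) • T p = p := fun n => by
    have hc : ContractingWith (1 - l n).toNNReal (fun p => (1 - l n) • T p) := by
      refine ⟨?_, LipschitzWith.of_dist_le_mul fun s t => ?_⟩
      · rw [Real.toNNReal_lt_one]; linarith [hl0 n]
      · rw [dist_eq_norm, dist_eq_norm, ← smul_sub, norm_smul, Real.norm_eq_abs,
          abs_of_pos (by linarith [hl1 n]), Real.coe_toNNReal _ (by linarith [hl1 n])]
        exact mul_le_mul_of_nonneg_left (hT s t) (by linarith [hl1 n])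
    exact ⟨_, hc.fixedPoint_isFixedPt⟩
  choose p hp using hfix
  have hbd : ∀ n, -(l n • p n) ∈ Metric.closedBall (0 : E) ‖T 0‖ := fun n => by
    rw [mem_closedBall_zero_iff, norm_neg, norm_smul, Real.norm_eq_abs, abs_of_pos (hl0 n)]
    have h1 : ‖p n‖ = (1 - l n) * ‖T (p n)‖ := by
      conv_lhs => rw [← hp n]
      rw [norm_smul, Real.norm_eq_abs, abs_of_pos (by linarith [hl1 n])]
    have h2 : ‖T (p n)‖ ≤ ‖p n‖ + ‖T 0‖ := by
      have h3 := hT (p n) 0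
      rw [sub_zero] at h3
      linarith [norm_sub_norm_le (T (p n)) (T 0)]
    have h4 : ‖p n‖ ≤ (1 - l n) * (‖p n‖ + ‖T 0‖) :=
      h1.le.trans (mul_le_mul_of_nonneg_left h2 (by linarith [hl1 n]))
    nlinarith [mul_nonneg (hl0 n).le (norm_nonneg (T 0))]
  obtain ⟨w, -, φ, hφ, hw⟩ := (isCompact_closedBall (0 : E) ‖T 0‖).tendsto_subseq hbd
  have hlφ : Tendsto (fun k => l (φ k)) atTop (𝓝 0) := hllim.comp hφ.tendsto_atTop
  have hG : ∀ n, p n - T (p n) = (1 - l n)⁻¹ • -(l n • p n) := fun n => by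
    have h1 : 1 - l n ≠ 0 := by linarith [hl1 n]
    have h2 : T (p n) = (1 - l n)⁻¹ • p n := by
      conv_rhs => rw [← hp n]
      rw [smul_smul, inv_mul_cancel₀ h1, one_smul]
    rw [h2, ← neg_smul, smul_smul]
    nth_rewrite 1 [← one_smul ℝ (p n)]
    rw [← sub_smul]
    congr 1
    field_simp
    ring
  have hGw : Tendsto (fun k => p (φ k) - T (p (φ k))) atTop (𝓝 w) := by
    have h1 : Tendsto (fun k => (1 - l (φ k))⁻¹) atTop (𝓝 1) := by
      simpa using (hlφ.const_sub 1).inv₀ (by norm_num)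
    have h2 := h1.smul hw
    rw [one_smul] at h2
    exact h2.congr fun k => (hG (φ k)).symm
  refine ⟨w, mem_closure_of_tendsto hGw (Eventually.of_forall fun k => ⟨p (φ k), rfl⟩), fun t => ?_⟩
  -- Monotonicity between `p (φ k)` and `t`, scaled by `l (φ k)`, so that `l (φ k) • t` vanishes.
  have h1 : Tendsto (fun k => inner ℝ ((p (φ k) - T (p (φ k))) - (t - T t))
      (-(-(l (φ k) • p (φ k))) - l (φ k) • t)) atTop
      (𝓝 (inner ℝ (w - (t - T t)) (-w - (0 : ℝ) • t))) :=
    (hGw.sub_const _).inner (hw.neg.sub (hlφ.smul_const t))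
  have h2 : 0 ≤ inner ℝ (w - (t - T t)) (-w - (0 : ℝ) • t) :=
    ge_of_tendsto' h1 fun k => by
      rw [neg_neg, ← smul_sub, inner_smul_right]
      exact mul_nonneg (hl0 _).le (inner_displacement_sub_nonneg hT _ _)
  rw [zero_smul, sub_zero, inner_neg_right, inner_sub_left, real_inner_self_eq_norm_sq] at h2
  linarith

/-- The increments of all inexact orbits with summable errors of an averaged operator have one
common limit, which depends on the operator only: the negative of its minimal displacement. -/
theorem exists_tendsto_increment [ProperSpace E] {T : E → E} {c : ℝ} (hc : 0 < c)
    (hT : ∀ s t, ‖T s - T t‖ ^ 2 + c * ‖(s - T s) - (t - T t)‖ ^ 2 ≤ ‖s - t‖ ^ 2) :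
    ∃ d : E, ∀ (s : ℕ → E) (e : ℕ → ℝ), Summable e → (∀ k, ‖s (k + 1) - T (s k)‖ ≤ e k) →
      Tendsto (fun k => s (k + 1) - s k) atTop (𝓝 d) := by
  have hne := norm_map_sub_le_of_averaged hc.le hT
  obtain ⟨w, hwcl, hw⟩ := exists_minimal_displacement hne
  refine ⟨-w, fun s e he hs => ?_⟩
  have hGs : Tendsto (fun k => s k - T (s k)) atTop (𝓝 w) := by
    rw [Metric.tendsto_atTop]
    intro ε hε
    -- An exact orbit starting at a point with displacement almost `w` keeps such displacements.
    have hcont : Tendsto (fun g : E => ‖g‖ ^ 2 - ‖w‖ ^ 2) (𝓝 w) (𝓝 0) := by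
      have : Continuous fun g : E => ‖g‖ ^ 2 - ‖w‖ ^ 2 := by fun_prop
      simpa using this.tendsto w
    have hev : ∀ᶠ g in 𝓝 w, ‖g‖ ^ 2 - ‖w‖ ^ 2 < (ε / 2) ^ 2 :=
      hcont.eventually_lt_const (by positivity)
    obtain ⟨_, hg, p, rfl⟩ := mem_closure_iff_nhds.1 hwcl _ hev
    have hG : ∀ k, ‖T^[k] p - T (T^[k] p)‖ ≤ ‖p - T p‖ := fun k => by
      induction k with
      | zero => exact le_rfl
      | succ k ih => rw [Function.iterate_succ_apply']; exact (hne _ _).trans ih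
    have hclose : ∀ k, ‖(T^[k] p - T (T^[k] p)) - w‖ < ε / 2 := fun k => by
      refine lt_of_pow_lt_pow_left₀ 2 (by positivity) ?_
      rw [norm_sub_sq_real]
      have h1 : ‖T^[k] p - T (T^[k] p)‖ ^ 2 ≤ ‖p - T p‖ ^ 2 := by gcongr; exact hG k
      have h2 := hw (T^[k] p)
      have h3 : ‖p - T p‖ ^ 2 - ‖w‖ ^ 2 < (ε / 2) ^ 2 := hg
      linarith
    have h1 := tendsto_displacement_sub_displacement hc hT (t := fun k => T^[k] p) he hs
      fun k => Function.iterate_succ_apply' T k p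
    obtain ⟨N, hN⟩ := Metric.tendsto_atTop.1 h1 (ε / 2) (by positivity)
    refine ⟨N, fun k hk => ?_⟩
    have h2 := hN k hk
    rw [dist_zero_right] at h2
    rw [dist_eq_norm, ← sub_add_sub_cancel _ (T^[k] p - T (T^[k] p)) w]
    exact (norm_add_le _ _).trans_lt (by linarith [hclose k])
  have herr : Tendsto (fun k => s (k + 1) - T (s k)) atTop (𝓝 0) :=
    squeeze_zero_norm hs he.tendsto_atTop_zero
  have := herr.sub hGs
  rw [zero_sub] at this
  exact this.congr fun k => by abel

end MinimalDisplacement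

/-! ### Firm nonexpansiveness of the projection -/

section Projection

theorem inner_sub_admmProj_le_zero {m : ℕ} {C : Set (EuclideanSpace ℝ (Fin m))} (hne : C.Nonempty)
    (hcl : IsClosed C) (hcv : Convex ℝ C) (v : EuclideanSpace ℝ (Fin m))
    {w : EuclideanSpace ℝ (Fin m)} (hw : w ∈ C) :
    inner ℝ (v - admmProj C v) (w - admmProj C v) ≤ 0 := by
  obtain ⟨hp, h⟩ := admmProj_spec hne hcl v
  refine (norm_eq_iInf_iff_real_inner_le_zero hcv hp).1 (le_antisymm ?_ ?_) w hw
  · have : Nonempty C := hne.to_subtype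
    exact le_ciInf fun w => h w w.2
  · exact ciInf_le (f := fun w : C => ‖v - w‖)
      ⟨0, by rintro _ ⟨w, rfl⟩; exact norm_nonneg _⟩ ⟨_, hp⟩

/-- The projection onto a closed convex set is firmly nonexpansive. -/
theorem inner_admmProj_sub_nonneg {m : ℕ} {C : Set (EuclideanSpace ℝ (Fin m))} (hne : C.Nonempty)
    (hcl : IsClosed C) (hcv : Convex ℝ C) (v v' : EuclideanSpace ℝ (Fin m)) :
    0 ≤ inner ℝ ((v - v') - (admmProj C v - admmProj C v')) (admmProj C v - admmProj C v') := by
  have h1 := inner_sub_admmProj_le_zero hne hcl hcv v (admmProj_spec hne hcl v').1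
  have h2 := inner_sub_admmProj_le_zero hne hcl hcv v' (admmProj_spec hne hcl v).1
  simp only [inner_sub_left, inner_sub_right] at h1 h2 ⊢
  linarith

end Projection

/-! ### The linear system -/

section LinearSystem

variable {n m : ℕ}

theorem admmStack_sub (x x' : EuclideanSpace ℝ (Fin n)) (z z' : EuclideanSpace ℝ (Fin m)) :
    admmStack x z - admmStack x' z' = admmStack (x - x') (z - z') := by
  ext i
  cases i <;> simp [admmStack]

theorem norm_admmStack_sq (x : EuclideanSpace ℝ (Fin n)) (z : EuclideanSpace ℝ (Fin m)) :
    ‖admmStack x z‖ ^ 2 = ‖x‖ ^ 2 + ‖z‖ ^ 2 := by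
  simp [EuclideanSpace.norm_sq_eq, admmStack]

theorem norm_fst_le_norm_admmStack (x : EuclideanSpace ℝ (Fin n)) (z : EuclideanSpace ℝ (Fin m)) :
    ‖x‖ ≤ ‖admmStack x z‖ :=
  le_of_sq_le_sq (by rw [norm_admmStack_sq]; linarith [sq_nonneg ‖z‖]) (norm_nonneg _)

theorem norm_snd_le_norm_admmStack (x : EuclideanSpace ℝ (Fin n)) (z : EuclideanSpace ℝ (Fin m)) :
    ‖z‖ ≤ ‖admmStack x z‖ :=
  le_of_sq_le_sq (by rw [norm_admmStack_sq]; linarith [sq_nonneg ‖x‖]) (norm_nonneg _)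

variable (P : Matrix (Fin n) (Fin n) ℝ) (q : EuclideanSpace ℝ (Fin n))
  (A : Matrix (Fin m) (Fin n) ℝ) (ρ σ : ℝ)

/-- The `x`-part of the exact solution of the linear system, as a function of `x` and of
`u = z - y / ρ`. It minimizes `½ xtᵀ P xt + qᵀ xt + σ/2 ‖xt - x‖² + ρ/2 ‖A xt - u‖²` over `xt`. -/
noncomputable def admmSolveFst (x : EuclideanSpace ℝ (Fin n)) (u : EuclideanSpace ℝ (Fin m)) :
    EuclideanSpace ℝ (Fin n) :=
  WithLp.toLp 2 fun i => admmSolve P q A ρ σ x 0 u (Sum.inl i)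

variable {P ρ σ}

theorem admmMatrix_mulVec_admmSolve (hP : P.PosSemidef) (hρ : 0 < ρ) (hσ : 0 < σ)
    (x : EuclideanSpace ℝ (Fin n)) (y z : EuclideanSpace ℝ (Fin m)) :
    admmMatrix P A ρ σ *ᵥ (admmSolve P q A ρ σ x y z).ofLp =
      Matrix.fromBlocks (σ • 1) (ρ • Aᵀ) 0 0 *ᵥ (admmStack x (z - ρ⁻¹ • y)).ofLp
        - (admmStack q 0).ofLp := by
  rw [admmSolve, Matrix.mulVec_mulVec,
    Matrix.mul_nonsing_inv _ (admmMatrix_isUnit_det hP A hρ hσ), Matrix.one_mulVec]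

/-- The second block row of the linear system says that `zt = A xt`. -/
theorem admmSolve_eq_stack (hP : P.PosSemidef) (hρ : 0 < ρ) (hσ : 0 < σ)
    (x : EuclideanSpace ℝ (Fin n)) (y z : EuclideanSpace ℝ (Fin m)) :
    admmSolve P q A ρ σ x y z = admmStack (admmSolveFst P q A ρ σ x (z - ρ⁻¹ • y))
      (A.toEuclideanLin (admmSolveFst P q A ρ σ x (z - ρ⁻¹ • y))) := by
  have h0 : admmSolve P q A ρ σ x y z = admmSolve P q A ρ σ x 0 (z - ρ⁻¹ • y) := by
    simp [admmSolve]
  rw [h0]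
  generalize z - ρ⁻¹ • y = u
  have h1 := admmMatrix_mulVec_admmSolve q A hP hρ hσ x 0 u
  ext i
  cases i with
  | inl i => rfl
  | inr i =>
    have h2 := congrFun h1 (Sum.inr i)
    simp only [admmMatrix, Matrix.fromBlocks_mulVec] at h2
    simp [admmStack, Matrix.smul_mulVec, Matrix.neg_mulVec] at h2
    have h3 : ρ * ((A *ᵥ ((admmSolve P q A ρ σ x 0 u).ofLp ∘ Sum.inl)) i
        - (admmSolve P q A ρ σ x 0 u).ofLp (Sum.inr i)) = 0 := by linarith
    have h4 := (mul_eq_zero.1 h3).resolve_left hρ.ne'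
    simp only [admmStack, Sum.elim_inr, Matrix.ofLp_toLpLin, Matrix.toLin'_apply]
    exact (sub_eq_zero.1 h4).symm

/-- The first-order optimality condition of the minimization problem solved by `admmSolveFst`. -/
theorem admmSolveFst_optimality (hP : P.PosSemidef) (hρ : 0 < ρ) (hσ : 0 < σ)
    (x : EuclideanSpace ℝ (Fin n)) (u : EuclideanSpace ℝ (Fin m)) :
    P.toEuclideanLin (admmSolveFst P q A ρ σ x u) + σ • (admmSolveFst P q A ρ σ x u - x)
      + ρ • A.toEuclideanLin.adjoint (A.toEuclideanLin (admmSolveFst P q A ρ σ x u) - u)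
      + q = 0 := by
  have h1 := admmMatrix_mulVec_admmSolve q A hP hρ hσ x 0 u
  rw [admmSolve_eq_stack q A hP hρ hσ, smul_zero, sub_zero] at h1
  rw [← Matrix.toEuclideanLin_conjTranspose_eq_adjoint, Matrix.conjTranspose_eq_transpose_of_trivial]
  generalize admmSolveFst P q A ρ σ x u = w at *
  ext i
  have h2 := congrFun h1 (Sum.inl i)
  simp only [admmMatrix, Matrix.fromBlocks_mulVec] at h2
  simp [Matrix.smul_mulVec, Matrix.add_mulVec, admmStack] at h2
  simp
  linarith

/-- Monotonicity of the solution of the linear system: two optimality conditions are subtracted and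
paired with the difference `d` of the solutions, and the term `⟪P d, d⟫ ≥ 0` is dropped. -/
theorem inner_admmSolveFst_sub_le_zero (hP : P.PosSemidef) (hρ : 0 < ρ) (hσ : 0 < σ)
    (x x' : EuclideanSpace ℝ (Fin n)) (u u' : EuclideanSpace ℝ (Fin m))
    {d : EuclideanSpace ℝ (Fin n)}
    (hd : d = admmSolveFst P q A ρ σ x u - admmSolveFst P q A ρ σ x' u') :
    σ * inner ℝ (d - (x - x')) d
      + ρ * inner ℝ (A.toEuclideanLin d - (u - u')) (A.toEuclideanLin d) ≤ 0 := by
  have h1 := admmSolveFst_optimality q A hP hρ hσ x u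
  have h2 := admmSolveFst_optimality q A hP hρ hσ x' u'
  have h3 : P.toEuclideanLin d + σ • (d - (x - x'))
      + ρ • A.toEuclideanLin.adjoint (A.toEuclideanLin d - (u - u')) = 0 := by
    rw [← sub_zero (0 : EuclideanSpace ℝ (Fin n))]
    nth_rewrite 1 [← h1]
    rw [← h2, hd]
    simp only [map_sub, smul_sub]
    abel
  have h4 := congrArg (fun w => inner ℝ w d) h3
  simp only [inner_add_left, inner_smul_left, inner_zero_left, LinearMap.adjoint_inner_left,
    conj_trivial] at h4
  have h5 : 0 ≤ inner ℝ (P.toEuclideanLin d) d := by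
    simpa using (Matrix.isPositive_toEuclideanLin_iff.2 hP).re_inner_nonneg_left d
  linarith

end LinearSystem

/-! ### ADMM as an averaged operator -/

section FixedPointOperator

variable {n m : ℕ}

/-- The state `(x, v)` of the ADMM iteration, scaled so that the Euclidean norm becomes the norm
`√(σ ‖x‖² + ρ ‖v‖²)` in which the iteration is averaged. -/
noncomputable def admmState (ρ σ : ℝ) (x : EuclideanSpace ℝ (Fin n))
    (v : EuclideanSpace ℝ (Fin m)) :
    WithLp 2 (EuclideanSpace ℝ (Fin n) × EuclideanSpace ℝ (Fin m)) :=
  WithLp.toLp 2 (√σ • x, √ρ • v)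

theorem admmState_add (ρ σ : ℝ) (x x' : EuclideanSpace ℝ (Fin n))
    (v v' : EuclideanSpace ℝ (Fin m)) :
    admmState ρ σ x v + admmState ρ σ x' v' = admmState ρ σ (x + x') (v + v') := by
  simp only [admmState, smul_add]
  rfl

theorem admmState_sub (ρ σ : ℝ) (x x' : EuclideanSpace ℝ (Fin n))
    (v v' : EuclideanSpace ℝ (Fin m)) :
    admmState ρ σ x v - admmState ρ σ x' v' = admmState ρ σ (x - x') (v - v') := by
  simp only [admmState, smul_sub]
  rfl

theorem norm_admmState_sq {ρ σ : ℝ} (hρ : 0 < ρ) (hσ : 0 < σ) (x : EuclideanSpace ℝ (Fin n))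
    (v : EuclideanSpace ℝ (Fin m)) :
    ‖admmState ρ σ x v‖ ^ 2 = σ * ‖x‖ ^ 2 + ρ * ‖v‖ ^ 2 := by
  rw [WithLp.prod_norm_sq_eq_of_L2]
  simp [admmState, norm_smul, mul_pow, hρ.le, hσ.le]

theorem norm_admmState_le {ρ σ : ℝ} (hρ : 0 < ρ) (hσ : 0 < σ) (x : EuclideanSpace ℝ (Fin n))
    (v : EuclideanSpace ℝ (Fin m)) :
    ‖admmState ρ σ x v‖ ≤ √σ * ‖x‖ + √ρ * ‖v‖ := by
  refine le_of_sq_le_sq ?_ (by positivity)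
  rw [norm_admmState_sq hρ hσ]
  have h : 0 ≤ √σ * ‖x‖ * (√ρ * ‖v‖) := by positivity
  nlinarith [Real.sq_sqrt hρ.le, Real.sq_sqrt hσ.le]

variable (P : Matrix (Fin n) (Fin n) ℝ) (q : EuclideanSpace ℝ (Fin n))
  (A : Matrix (Fin m) (Fin n) ℝ) (C : Set (EuclideanSpace ℝ (Fin m))) (ρ σ α : ℝ)

/-- The increment in `x` of exact ADMM at the state `(x, v)`, where `v` stands for `z + y / ρ` and
`z` is the projection of `v`, so that `z - y / ρ = 2 z - v`. -/
noncomputable def admmIncrFst (x : EuclideanSpace ℝ (Fin n)) (v : EuclideanSpace ℝ (Fin m)) :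
    EuclideanSpace ℝ (Fin n) :=
  α • (admmSolveFst P q A ρ σ x ((2 : ℝ) • admmProj C v - v) - x)

/-- The increment in `v` of exact ADMM at the state `(x, v)`, with `v` as in `admmIncrFst`. -/
noncomputable def admmIncrSnd (x : EuclideanSpace ℝ (Fin n)) (v : EuclideanSpace ℝ (Fin m)) :
    EuclideanSpace ℝ (Fin m) :=
  α • (A.toEuclideanLin (admmSolveFst P q A ρ σ x ((2 : ℝ) • admmProj C v - v)) - admmProj C v)

/-- One step of exact ADMM as an operator on scaled states. -/
noncomputable def admmOperator
    (s : WithLp 2 (EuclideanSpace ℝ (Fin n) × EuclideanSpace ℝ (Fin m))) :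
    WithLp 2 (EuclideanSpace ℝ (Fin n) × EuclideanSpace ℝ (Fin m)) :=
  s + admmState ρ σ (admmIncrFst P q A C ρ σ α ((√σ)⁻¹ • s.fst) ((√ρ)⁻¹ • s.snd))
    (admmIncrSnd P q A C ρ σ α ((√σ)⁻¹ • s.fst) ((√ρ)⁻¹ • s.snd))

variable {ρ σ α}

theorem admmOperator_admmState (hρ : 0 < ρ) (hσ : 0 < σ) (x : EuclideanSpace ℝ (Fin n))
    (v : EuclideanSpace ℝ (Fin m)) :
    admmOperator P q A C ρ σ α (admmState ρ σ x v) = admmState ρ σ x v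
      + admmState ρ σ (admmIncrFst P q A C ρ σ α x v) (admmIncrSnd P q A C ρ σ α x v) := by
  have h1 := (Real.sqrt_pos.2 hρ).ne'
  have h2 := (Real.sqrt_pos.2 hσ).ne'
  simp [admmOperator, admmState, smul_smul, h1, h2]

theorem exists_eq_admmState (hρ : 0 < ρ) (hσ : 0 < σ)
    (s : WithLp 2 (EuclideanSpace ℝ (Fin n) × EuclideanSpace ℝ (Fin m))) :
    ∃ x v, s = admmState ρ σ x v := by
  have h1 := (Real.sqrt_pos.2 hρ).ne'
  have h2 := (Real.sqrt_pos.2 hσ).ne'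
  refine ⟨(√σ)⁻¹ • s.fst, (√ρ)⁻¹ • s.snd, ?_⟩
  simp only [admmState, smul_smul, mul_inv_cancel₀ h1, mul_inv_cancel₀ h2, one_smul]
  rfl

variable {P C}

/-- The ADMM operator is averaged: the optimality condition of the linear step, which is monotone
in the data, is combined with the firm nonexpansiveness of the projection. -/
theorem admmOperator_averaged (hP : P.PosSemidef) (hCne : C.Nonempty) (hCcl : IsClosed C)
    (hCcv : Convex ℝ C) (hρ : 0 < ρ) (hσ : 0 < σ) (hα0 : 0 < α)
    (s t : WithLp 2 (EuclideanSpace ℝ (Fin n) × EuclideanSpace ℝ (Fin m))) :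
    ‖admmOperator P q A C ρ σ α s - admmOperator P q A C ρ σ α t‖ ^ 2 + (2 / α - 1) *
      ‖(s - admmOperator P q A C ρ σ α s) - (t - admmOperator P q A C ρ σ α t)‖ ^ 2
      ≤ ‖s - t‖ ^ 2 := by
  obtain ⟨x, v, rfl⟩ := exists_eq_admmState hρ hσ s
  obtain ⟨x', v', rfl⟩ := exists_eq_admmState hρ hσ t
  simp only [admmOperator_admmState P q A C hρ hσ, sub_add_cancel_left]
  have h1 := inner_admmSolveFst_sub_le_zero q A hP hρ hσ x x'
    ((2 : ℝ) • admmProj C v - v) ((2 : ℝ) • admmProj C v' - v') rfl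
  have h2 := inner_admmProj_sub_nonneg hCne hCcl hCcv v v'
  rw [add_sub_add_comm, neg_sub_neg, norm_sub_rev (admmState ρ σ (admmIncrFst _ _ _ _ _ _ _ x' v') _)]
  simp only [admmState_sub, admmState_add, admmIncrFst, admmIncrSnd, ← smul_sub]
  set X := admmSolveFst P q A ρ σ x ((2 : ℝ) • admmProj C v - v)
  set X' := admmSolveFst P q A ρ σ x' ((2 : ℝ) • admmProj C v' - v')
  have e1 : X - x - (X' - x') = (X - X') - (x - x') := by abel
  have e2 : A.toEuclideanLin X - admmProj C v - (A.toEuclideanLin X' - admmProj C v') =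
      A.toEuclideanLin (X - X') - (admmProj C v - admmProj C v') := by rw [map_sub]; abel
  have e3 : (2 : ℝ) • admmProj C v - v - ((2 : ℝ) • admmProj C v' - v') =
      (2 : ℝ) • (admmProj C v - admmProj C v') - (v - v') := by module
  rw [e3] at h1
  rw [e1, e2]
  generalize A.toEuclideanLin (X - X') = dZ at *
  generalize X - X' = dX at *
  generalize admmProj C v - admmProj C v' = dz at *
  generalize v - v' = dv at *
  generalize x - x' = dx at *
  simp only [norm_admmState_sq hρ hσ, norm_add_sq_real, norm_smul, inner_smul_right, mul_pow,
    Real.norm_eq_abs, sq_abs]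
  have h3 : σ * inner ℝ dx (dX - dx) + ρ * inner ℝ dv (dZ - dz) + σ * ‖dX - dx‖ ^ 2
      + ρ * ‖dZ - dz‖ ^ 2 ≤ 0 := by
    have h4 := mul_nonneg hρ.le h2
    simp only [← real_inner_self_eq_norm_sq, inner_sub_left, inner_sub_right, inner_smul_left,
      conj_trivial, real_inner_comm dx dX, real_inner_comm dz dZ]
      at h1 h4 ⊢
    linarith
  have h5 : (2 / α - 1) * (α ^ 2) = 2 * α - α ^ 2 := by field_simp
  generalize ‖dX - dx‖ ^ 2 = a at *
  generalize ‖dZ - dz‖ ^ 2 = b at *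
  -- The constant `2 / α - 1` turns the goal into `2 α` times the bound `h3`.
  have h6 : (2 / α - 1) * (σ * (α ^ 2 * a) + ρ * (α ^ 2 * b))
      = (2 * α - α ^ 2) * (σ * a + ρ * b) := by rw [← h5]; ring
  rw [h6]
  nlinarith [mul_nonneg_of_nonpos_of_nonpos h3 (neg_nonpos.2 hα0.le)]

end FixedPointOperator

/-! ### Approximate ADMM as an inexact orbit -/

section Iterates

variable {n m : ℕ}

/-- For fixed `x`, the solution of the linear system is Lipschitz in `u = z - y / ρ`. -/
theorem norm_admmState_admmSolveFst_sub_le {P : Matrix (Fin n) (Fin n) ℝ} (hP : P.PosSemidef)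
    (q : EuclideanSpace ℝ (Fin n)) (A : Matrix (Fin m) (Fin n) ℝ) {ρ σ : ℝ} (hρ : 0 < ρ)
    (hσ : 0 < σ) (x : EuclideanSpace ℝ (Fin n)) (u u' : EuclideanSpace ℝ (Fin m)) :
    ‖admmState ρ σ (admmSolveFst P q A ρ σ x u - admmSolveFst P q A ρ σ x u')
      (A.toEuclideanLin (admmSolveFst P q A ρ σ x u) -
        A.toEuclideanLin (admmSolveFst P q A ρ σ x u'))‖ ≤ √ρ * ‖u - u'‖ := by
  have h1 := inner_admmSolveFst_sub_le_zero q A hP hρ hσ x x u u' rfl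
  rw [← map_sub]
  refine le_of_sq_le_sq ?_ (by positivity)
  rw [norm_admmState_sq hρ hσ, mul_pow, Real.sq_sqrt hρ.le]
  generalize admmSolveFst P q A ρ σ x u - admmSolveFst P q A ρ σ x u' = d at *
  rw [sub_self, sub_zero, inner_sub_left, real_inner_self_eq_norm_sq,
    real_inner_self_eq_norm_sq] at h1
  have h2 := real_inner_le_norm (u - u') (A.toEuclideanLin d)
  have h3 : ‖u - u'‖ * ‖A.toEuclideanLin d‖ ≤ (‖u - u'‖ ^ 2 + ‖A.toEuclideanLin d‖ ^ 2) / 2 := by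
    nlinarith [sq_nonneg (‖u - u'‖ - ‖A.toEuclideanLin d‖)]
  have h4 : 0 ≤ σ * ‖d‖ ^ 2 := by positivity
  nlinarith [mul_le_mul_of_nonneg_left (h2.trans h3) hρ.le]

variable {P : Matrix (Fin n) (Fin n) ℝ} {q : EuclideanSpace ℝ (Fin n)}
  {A : Matrix (Fin m) (Fin n) ℝ} {C : Set (EuclideanSpace ℝ (Fin m))} {ρ σ α : ℝ}
  {μ ν : ℕ → ℝ} {x xt : ℕ → EuclideanSpace ℝ (Fin n)} {y z zt : ℕ → EuclideanSpace ℝ (Fin m)}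

namespace IsApproxADMM

theorem z_add_y_step (h : IsApproxADMM P q A C ρ σ α μ ν x xt y z zt) (hρ : 0 < ρ) (k : ℕ) :
    z (k + 1) + ρ⁻¹ • y (k + 1) = α • zt (k + 1) + (1 - α) • z k + ρ⁻¹ • y k := by
  rw [h.y_step, smul_add, smul_smul, inv_mul_cancel₀ hρ.ne', one_smul]
  abel

theorem norm_linear_error (h : IsApproxADMM P q A C ρ σ α μ ν x xt y z zt) (hP : P.PosSemidef)
    (hρ : 0 < ρ) (hσ : 0 < σ) (k : ℕ) :
    ‖xt (k + 1) - admmSolveFst P q A ρ σ (x k) (z k - ρ⁻¹ • y k)‖ ≤ μ k ∧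
      ‖zt (k + 1) - A.toEuclideanLin
        (admmSolveFst P q A ρ σ (x k) (z k - ρ⁻¹ • y k))‖ ≤ μ k := by
  have h1 := h.linear_step k
  rw [admmSolve_eq_stack q A hP hρ hσ, admmStack_sub] at h1
  exact ⟨(norm_fst_le_norm_admmStack _ _).trans h1, (norm_snd_le_norm_admmStack _ _).trans h1⟩

/-- From the second iterate on, approximate ADMM is an inexact orbit of the ADMM operator. The
first one is exempt, because the initial `z` need not be close to the projection of `z + y / ρ`. -/
theorem norm_state_sub_admmOperator_le (h : IsApproxADMM P q A C ρ σ α μ ν x xt y z zt)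
    (hP : P.PosSemidef) (hρ : 0 < ρ) (hσ : 0 < σ) (hα0 : 0 < α) (k : ℕ) :
    ‖admmState ρ σ (x (k + 2)) (z (k + 2) + ρ⁻¹ • y (k + 2)) - admmOperator P q A C ρ σ α
      (admmState ρ σ (x (k + 1)) (z (k + 1) + ρ⁻¹ • y (k + 1)))‖
      ≤ α * ((√σ + √ρ) * μ (k + 1) + 3 * √ρ * ν k) := by
  obtain ⟨hx, hz⟩ := h.norm_linear_error hP hρ hσ (k + 1)
  have hproj := h.z_step k
  rw [← h.z_add_y_step hρ k] at hproj
  rw [admmOperator_admmState P q A C hρ hσ, h.z_add_y_step hρ (k + 1), h.x_step (k + 1)]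
  set v := z (k + 1) + ρ⁻¹ • y (k + 1) with hv
  set u := z (k + 1) - ρ⁻¹ • y (k + 1) with hu
  set p := admmProj C v
  set X := admmSolveFst P q A ρ σ (x (k + 1)) u with hX
  set X' := admmSolveFst P q A ρ σ (x (k + 1)) ((2 : ℝ) • p - v) with hX'
  have hlip : ‖admmState ρ σ (X - X') (A.toEuclideanLin X - A.toEuclideanLin X')‖
      ≤ √ρ * (2 * ν k) := by
    refine (norm_admmState_admmSolveFst_sub_le hP q A hρ hσ _ _ _).trans ?_
    have h1 : u - ((2 : ℝ) • p - v) = (2 : ℝ) • (z (k + 1) - p) := by rw [hu, hv]; module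
    rw [h1, norm_smul, Real.norm_ofNat]
    gcongr
  -- The three contributions: linear system, its data through the projection, the projection.
  have hsplit : admmState ρ σ (α • xt (k + 1 + 1) + (1 - α) • x (k + 1))
        (α • zt (k + 1 + 1) + (1 - α) • z (k + 1) + ρ⁻¹ • y (k + 1)) -
      (admmState ρ σ (x (k + 1)) v +
        admmState ρ σ (admmIncrFst P q A C ρ σ α (x (k + 1)) v)
          (admmIncrSnd P q A C ρ σ α (x (k + 1)) v)) =
      α • (admmState ρ σ (xt (k + 1 + 1) - X) (zt (k + 1 + 1) - A.toEuclideanLin X)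
        + admmState ρ σ (X - X') (A.toEuclideanLin X - A.toEuclideanLin X')
        - admmState ρ σ 0 (z (k + 1) - p)) := by
    have hsmul : ∀ a b, α • admmState ρ σ a b = admmState (n := n) (m := m) ρ σ (α • a) (α • b) :=
      fun a b => by simp only [admmState, smul_comm _ α]; rfl
    rw [admmState_add, admmState_add, admmState_sub, admmState_sub, hsmul, admmIncrFst, admmIncrSnd]
    congr 1
    · module
    · rw [hv]; module
  rw [hsplit, norm_smul, Real.norm_eq_abs, abs_of_pos hα0]
  refine mul_le_mul_of_nonneg_left ?_ hα0.le
  have h1 := norm_admmState_le hρ hσ (xt (k + 1 + 1) - X) (zt (k + 1 + 1) - A.toEuclideanLin X)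
  have h2 := norm_admmState_le hρ hσ (0 : EuclideanSpace ℝ (Fin n)) (z (k + 1) - p)
  have h3 : √σ * ‖xt (k + 1 + 1) - X‖ ≤ √σ * μ (k + 1) := by gcongr
  have h4 : √ρ * ‖zt (k + 1 + 1) - A.toEuclideanLin X‖ ≤ √ρ * μ (k + 1) := by gcongr
  have h5 : √ρ * ‖z (k + 1) - p‖ ≤ √ρ * ν k := by gcongr
  rw [norm_zero, mul_zero, zero_add] at h2
  refine (norm_sub_le _ _).trans ((add_le_add_left (norm_add_le _ _) _).trans ?_)
  linarith

/-- Since `zt` asymptotically equals `A xt`, the iterates satisfy `z k = A (x k) + c k` with `c`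
convergent, so that the increments of `y` converge whenever those of `x` and `z + y / ρ` do. -/
theorem tendsto_y_increment (h : IsApproxADMM P q A C ρ σ α μ ν x xt y z zt)
    (hP : P.PosSemidef) (hρ : 0 < ρ) (hσ : 0 < σ) (hα0 : 0 < α) (hμ : Summable μ)
    {δx : EuclideanSpace ℝ (Fin n)} {δv : EuclideanSpace ℝ (Fin m)}
    (hx : Tendsto (fun k => x (k + 1) - x k) atTop (𝓝 δx))
    (hv : Tendsto (fun k => (z (k + 1) + ρ⁻¹ • y (k + 1)) - (z k + ρ⁻¹ • y k)) atTop (𝓝 δv)) :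
    Tendsto (fun k => y (k + 1) - y k) atTop (𝓝 (ρ • (δv - A.toEuclideanLin δx))) := by
  have hA : Continuous A.toEuclideanLin := LinearMap.continuous_of_finiteDimensional _
  have hAx := (hA.tendsto δx).comp hx
  have herr : Tendsto (fun k => zt (k + 1) - A.toEuclideanLin (xt (k + 1))) atTop (𝓝 0) := by
    have h1 := squeeze_zero_norm (fun k => (h.norm_linear_error hP hρ hσ k).1) hμ.tendsto_atTop_zero
    have h2 := squeeze_zero_norm (fun k => (h.norm_linear_error hP hρ hσ k).2) hμ.tendsto_atTop_zero
    have h3 := h2.sub ((hA.tendsto 0).comp h1)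
    rw [map_zero, sub_zero] at h3
    refine h3.congr fun k => ?_
    simp only [Function.comp_apply, map_sub]
    abel
  have hc : Tendsto (fun k => z k - A.toEuclideanLin (x k)) atTop
      (𝓝 (α⁻¹ • A.toEuclideanLin δx + 0 - α⁻¹ • δv)) := by
    refine (((hAx.const_smul α⁻¹).add herr).sub (hv.const_smul α⁻¹)).congr fun k => ?_
    have h1 : xt (k + 1) = x k + α⁻¹ • (x (k + 1) - x k) := by
      rw [h.x_step k]
      have : α • xt (k + 1) + (1 - α) • x k - x k = α • (xt (k + 1) - x k) := by module
      rw [this, smul_smul, inv_mul_cancel₀ hα0.ne', one_smul]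
      abel
    have h2 : zt (k + 1)
        = z k + α⁻¹ • ((z (k + 1) + ρ⁻¹ • y (k + 1)) - (z k + ρ⁻¹ • y k)) := by
      rw [h.z_add_y_step hρ k]
      have : α • zt (k + 1) + (1 - α) • z k + ρ⁻¹ • y k - (z k + ρ⁻¹ • y k)
          = α • (zt (k + 1) - z k) := by module
      rw [this, smul_smul, inv_mul_cancel₀ hα0.ne', one_smul]
      abel
    simp only [Function.comp_apply]
    rw [h1, h2, map_add, map_smul]
    abel
  have hz : Tendsto (fun k => z (k + 1) - z k) atTop (𝓝 (A.toEuclideanLin δx)) := by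
    have h1 := (((tendsto_add_atTop_iff_nat 1).2 hc).sub hc).add hAx
    rw [sub_self, zero_add] at h1
    refine h1.congr fun k => ?_
    simp only [Function.comp_apply, map_sub]
    abel
  refine ((hv.sub hz).const_smul ρ).congr fun k => ?_
  have h1 : (z (k + 1) + ρ⁻¹ • y (k + 1)) - (z k + ρ⁻¹ • y k) - (z (k + 1) - z k)
      = ρ⁻¹ • (y (k + 1) - y k) := by module
  rw [h1, smul_smul, mul_inv_cancel₀ hρ.ne', one_smul]

end IsApproxADMM

/-- The increments of `x` and `y` have limits which are common to all runs of approximate ADMM with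
summable errors. -/
theorem exists_tendsto_admm_increments (hP : P.PosSemidef) (hCne : C.Nonempty)
    (hCcl : IsClosed C) (hCcv : Convex ℝ C) (hρ : 0 < ρ) (hσ : 0 < σ) (hα0 : 0 < α) (hα2 : α < 2) :
    ∃ (δx : EuclideanSpace ℝ (Fin n)) (δy : EuclideanSpace ℝ (Fin m)),
      ∀ (μ ν : ℕ → ℝ) (x xt : ℕ → EuclideanSpace ℝ (Fin n))
        (y z zt : ℕ → EuclideanSpace ℝ (Fin m)), Summable μ → Summable ν →
        IsApproxADMM P q A C ρ σ α μ ν x xt y z zt →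
          Tendsto (fun k => x (k + 1) - x k) atTop (𝓝 δx) ∧
          Tendsto (fun k => y (k + 1) - y k) atTop (𝓝 δy) := by
  have hc : 0 < 2 / α - 1 := by rw [sub_pos, one_lt_div hα0]; exact hα2
  obtain ⟨d, hd⟩ := exists_tendsto_increment hc
    (admmOperator_averaged q A hP hCne hCcl hCcv hρ hσ hα0)
  obtain ⟨δx, δv, rfl⟩ := exists_eq_admmState hρ hσ d
  refine ⟨δx, ρ • (δv - A.toEuclideanLin δx), fun μ ν x xt y z zt hμ hν h => ?_⟩
  have hs := hd (fun k => admmState ρ σ (x (k + 1)) (z (k + 1) + ρ⁻¹ • y (k + 1))) _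
    (((((summable_nat_add_iff 1).2 hμ).mul_left _).add (hν.mul_left _)).mul_left _)
    (fun k => h.norm_state_sub_admmOperator_le hP hρ hσ hα0 k)
  simp only [admmState_sub] at hs
  have hsρ := (Real.sqrt_pos.2 hρ).ne'
  have hsσ := (Real.sqrt_pos.2 hσ).ne'
  have hx : Tendsto (fun k => x (k + 1) - x k) atTop (𝓝 δx) := by
    rw [← tendsto_add_atTop_iff_nat 1]
    have h1 := (((WithLp.continuous_fst 2 _ _).tendsto _).comp hs).const_smul (√σ)⁻¹
    simpa [Function.comp_def, admmState, smul_smul, hsσ] using h1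
  have hv : Tendsto (fun k => (z (k + 1) + ρ⁻¹ • y (k + 1)) - (z k + ρ⁻¹ • y k)) atTop
      (𝓝 δv) := by
    rw [← tendsto_add_atTop_iff_nat 1]
    have h1 := (((WithLp.continuous_snd 2 _ _).tendsto _).comp hs).const_smul (√ρ)⁻¹
    simpa [Function.comp_def, admmState, smul_smul, hsρ] using h1
  exact ⟨hx, h.tendsto_y_increment hP hρ hσ hα0 hμ hx hv⟩

end Iterates

theorem mainTheorem3 {n m : ℕ} (P : Matrix (Fin n) (Fin n) ℝ) (hP : P.PosSemidef)
    (q : EuclideanSpace ℝ (Fin n)) (A : Matrix (Fin m) (Fin n) ℝ)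
    (C : Set (EuclideanSpace ℝ (Fin m))) (hCne : C.Nonempty) (hCcl : IsClosed C)
    (hCcv : Convex ℝ C) (ρ σ α : ℝ) (hρ : 0 < ρ) (hσ : 0 < σ) (hα0 : 0 < α) (hα2 : α < 2)
    (μ ν : ℕ → ℝ) (hμ : Summable μ) (hν : Summable ν)
    (x xt : ℕ → EuclideanSpace ℝ (Fin n)) (y z zt : ℕ → EuclideanSpace ℝ (Fin m))
    (hrun : IsApproxADMM P q A C ρ σ α μ ν x xt y z zt) :
    ∃ (δx : EuclideanSpace ℝ (Fin n)) (δy : EuclideanSpace ℝ (Fin m)),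
      Tendsto (fun k => x (k + 1) - x k) atTop (𝓝 δx) ∧
      Tendsto (fun k => y (k + 1) - y k) atTop (𝓝 δy) ∧
      ∀ (x' xt' : ℕ → EuclideanSpace ℝ (Fin n)) (y' z' zt' : ℕ → EuclideanSpace ℝ (Fin m)),
        IsApproxADMM P q A C ρ σ α (fun _ => 0) (fun _ => 0) x' xt' y' z' zt' →
          Tendsto (fun k => x' (k + 1) - x' k) atTop (𝓝 δx) ∧
          Tendsto (fun k => y' (k + 1) - y' k) atTop (𝓝 δy) := by
  obtain ⟨δx, δy, h⟩ := exists_tendsto_admm_increments (q := q) (A := A) hP hCne hCcl hCcv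
    hρ hσ hα0 hα2
  obtain ⟨hx, hy⟩ := h μ ν x xt y z zt hμ hν hrun
  exact ⟨δx, δy, hx, hy, fun x' xt' y' z' zt' hrun' =>
    h _ _ x' xt' y' z' zt' summable_zero summable_zero hrun'⟩
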